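/- Let $\mathbb K$ be an algebraically closed field of characteristic zero and let $\mathfrak g$ be a finite-dimensional reductive Lie algebra over $\mathbb K$ (that is, its radical equals its center). Let $\mathfrak g_S$ be the maximal semisimple ideal of $\mathfrak g$ and let $n$ be the dimension of the center $\mathfrak g_Z$ of $\mathfrak g$, so that $\mathfrak g = \mathfrak g_Z \oplus \mathfrak g_S$ with $\mathfrak g_Z \cong \mathbb K^n$. Let $\mathfrak q$ be a parabolic subalgebra of $\mathfrak g$: a subalgebra that contains $\mathfrak g_Z$ and for which $\mathfrak q_S = \mathfrak q \cap \mathfrak g_S$ is a parabolic subalgebra of $\mathfrak g_S$, so that $\mathfrak q = \mathfrak g_Z \oplus \mathfrak q_S$. Here a subalgebra of $\mathfrak g_S$ is called parabolic if it contains a Borel subalgebra, and a Borel subalgebra of $\mathfrak g_S$ is a subalgebra of the form $\mathfrak h \oplus \bigoplus_{\alpha \in \Phi^+} \mathfrak g_\alpha$ (direct sum of vector spaces), where $\mathfrak h$ is a Cartan subalgebra of $\mathfrak g_S$, $\Phi$ is its root system, $\mathfrak g_\alpha \subseteq \mathfrak g_S$ is the root space of $\alpha \in \Phi$, and $\Phi^+$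 is the set of positive roots with respect to some base $\Delta$ of $\Phi$. Then there are a Cartan subalgebra $\mathfrak h$ of $\mathfrak g_S$ with root system $\Phi$, a base $\Delta$ of $\Phi$ and a subset $\Delta' \subseteq \Delta$ such that \[ \mathfrak q_S = \mathfrak h \oplus \bigoplus_{\alpha \in \Phi'} \mathfrak g_\alpha, \qquad \Phi' = \Phi^+ \cup \left(\Phi \cap \operatorname{Span}_{\mathbb K} \Delta'\right), \] and for every such choice of $\mathfrak h$, $\Delta$ and $\Delta'$ the Lie algebra $\operatorname{Der} \mathfrak q$ of derivations of $\mathfrak q$ satisfies \[ \dim \operatorname{Der} \mathfrak q = \left( n + |\Delta| - |\Delta'| \right) n + \dim \mathfrak q_S . \] -/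

import Mathlib

/-!
Parabolic subalgebras of reductive Lie algebras over an algebraically closed field of
characteristic zero.

Mathlib's `LieAlgebra.HasCentralRadical` (the radical is the center) is the notion of a reductive
Lie algebra, and `LieAlgebra.IsKilling.rootSystem H` is the root system `Φ` of a semisimple Lie
algebra with respect to its Cartan subalgebra `H`.
-/

namespace ParabolicDer

open LieAlgebra LieAlgebra.IsKilling

section Semisimple

variable {K L : Type*} [Field K] [CharZero K] [IsAlgClosed K] [LieRing L] [LieAlgebra K L]
  [FiniteDimensional K L] [LieAlgebra.IsSemisimple K L]

/-- The set `Φ⁺` of positive roots with respect to the base `b`: the roots that are sums of simple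
roots. -/
def positiveRoots (H : LieSubalgebra K L) [H.IsCartanSubalgebra] (b : (rootSystem H).Base) :
    Set H.root :=
  {α | (rootSystem H).root α ∈ AddSubmonoid.closure ((rootSystem H).root '' b.support)}

/-- The set of roots `Φ' = Φ⁺ ∪ (Φ ∩ Span Δ')` attached to a set `D` (standing for `Δ'`) of simple
roots. -/
def parabolicRoots (H : LieSubalgebra K L) [H.IsCartanSubalgebra] (b : (rootSystem H).Base)
    (D : Finset H.root) : Set H.root :=
  positiveRoots H b ∪
    {α | (rootSystem H).root α ∈ Submodule.span K ((rootSystem H).root '' D)}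

/-- The subspace `H ∔ ∑_{α ∈ S} L_α` of `L`, for a set `S` of roots. -/
def cartanAddRootSpaces (H : LieSubalgebra K L) [H.IsCartanSubalgebra] (S : Set H.root) :
    Submodule K L :=
  H.toSubmodule ⊔ ⨆ α ∈ S, (rootSpace H (α.1 : H → K)).toSubmodule

/-- `p` is the Borel subalgebra `H ∔ ∑_{α ∈ Φ⁺} L_α` given by a Cartan subalgebra `H` and a
base `b` of the root system. -/
def IsStandardBorel (H : LieSubalgebra K L) [H.IsCartanSubalgebra] (b : (rootSystem H).Base)
    (p : LieSubalgebra K L) : Prop :=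
  p.toSubmodule = cartanAddRootSpaces H (positiveRoots H b)

/-- `p` is the standard parabolic subalgebra `H ∔ ∑_{α ∈ Φ'} L_α` relative to `(H, Φ, Δ)` that
corresponds to the set `D` of simple roots (`D` stands for `Δ'` and `b` for the base `Δ`). -/
def IsStandardParabolic (H : LieSubalgebra K L) [H.IsCartanSubalgebra] (b : (rootSystem H).Base)
    (D : Finset H.root) (p : LieSubalgebra K L) : Prop :=
  D ⊆ b.support ∧ p.toSubmodule = cartanAddRootSpaces H (parabolicRoots H b D)

/-- A Borel subalgebra of a semisimple Lie algebra: a subalgebra `H ∔ ∑_{α ∈ Φ⁺} L_α` for some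
Cartan subalgebra `H` and some base of the root system of `H`. -/
def IsBorel (p : LieSubalgebra K L) : Prop :=
  ∃ (H : LieSubalgebra K L) (_ : H.IsCartanSubalgebra) (b : (rootSystem H).Base),
    IsStandardBorel H b p

/-- A parabolic subalgebra of a semisimple Lie algebra: a subalgebra that contains a Borel
subalgebra. -/
def IsParabolic (p : LieSubalgebra K L) : Prop :=
  ∃ B : LieSubalgebra K L, IsBorel B ∧ B ≤ p

end Semisimple

section Reductive

variable {K L : Type*} [Field K] [CharZero K] [IsAlgClosed K] [LieRing L] [LieAlgebra K L]
  [FiniteDimensional K L]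

/-- The subalgebra `q_S = q ∩ I` of the ideal `I`. -/
def semisimplePart (I : LieIdeal K L) (q : LieSubalgebra K L) : LieSubalgebra K I :=
  q.comap I.incl

/-- A parabolic subalgebra `q` of a reductive Lie algebra `L` with maximal semisimple ideal `I`:
`q` contains the center of `L`, and `q ∩ I` is a parabolic subalgebra of `I`. As `L` is the direct
sum of its center and `I`, such a `q` is the direct sum of the center of `L` and `q ∩ I`. -/
def IsReductiveParabolic (I : LieIdeal K L) [LieAlgebra.IsSemisimple K I]
    (q : LieSubalgebra K L) : Prop :=
  (LieAlgebra.center K L).toSubmodule ≤ q.toSubmodule ∧ IsParabolic (semisimplePart I q)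

end Reductive

end ParabolicDer

/-!
The proof rests on three facts.

*The reductive algebra splits.* Its centre `Z` and its derived algebra are complementary, and the
derived algebra is the maximal semisimple ideal (`eq_derivedSeries_one_of_maximal`). The crucial
point is `eq_zero_of_mem_center_of_mem_derivedSeries_one`: central extensions of a semisimple Lie
algebra split, because a 2-cocycle of it corresponds under the Killing form to a derivation, which
is inner. It follows that a parabolic subalgebra `q` is the direct sum of `Z` and of its semisimple
part `p`.

*Derivations of `Z ⊕ p`.* If `p` has trivial centre and only inner derivations, a derivation of
`Z ⊕ p` is uniquely the sum of a linear map from the abelianization `Z ⊕ p / [p, p]` to `Z` and of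
`ad x` with `x ∈ p` (`finrank_lieDerivation_of_isCompl_center`). This accounts for both terms of the
formula.

*Standard parabolic subalgebras.* Let `p = H ∔ ∑_{α ∈ S} L_α`, where `S` contains the positive
roots. The centralizer of a regular element is `H`, hence the centre of `p` is trivial, and a
derivation of `p` may be altered by an inner one so as to preserve `H`. It then kills `H` and acts
by scalars on the root spaces; these scalars are additive in the root, and hence given by an element
of `H` (`exists_derivation_eq_lie`). A linear form on `p` that kills `[p, p]` is `κ(t, ·)`, for the
Killing form `κ` and an element `t ∈ H` annihilated by the simple roots whose negatives are in `S`;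
thus `p / [p, p]` has dimension `|Δ| - |Δ'|` (`finrank_quotient_derivedSeries_one`).

That every parabolic subalgebra is standard (`IsParabolic.exists_isStandardParabolic`) is a
statement about sets of roots that contain the positive ones and are closed under addition
(`eq_parabolicRoots_of_closed`), since `⁅L_α, L_β⁆ ≠ 0` whenever `α + β` is a root
(`lie_ne_zero_of_eq_add`).
-/

namespace ParabolicDer

open LieAlgebra LieAlgebra.IsKilling

/-! ### Reductive Lie algebras -/

section ReductiveDecomposition

variable {K L : Type*} [Field K] [LieRing L] [LieAlgebra K L]

theorem lie_mem_derivedSeries_one (x y : L) : ⁅x, y⁆ ∈ derivedSeries K L 1 :=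
  LieSubmodule.lie_mem_lie (LieSubmodule.mem_top (R := K) (L := L) x) (LieSubmodule.mem_top y)

/-- A subspace containing all brackets contains the derived algebra. -/
theorem derivedSeries_one_le {N : Submodule K L} (h : ∀ x y : L, ⁅x, y⁆ ∈ N) :
    (derivedSeries K L 1).toSubmodule ≤ N := by
  have := coe_derivedSeries_one_eq K L
  have h2 : (derivedSeries K L 1).toSubmodule = Submodule.span K {⁅x, y⁆ | (x : L) (y : L)} := this
  rw [h2, Submodule.span_le]
  rintro _ ⟨x, y, rfl⟩
  exact h x y

/-- Nondegeneracy of an invariant form makes a centreless Lie algebra perfect. -/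
theorem derivedSeries_one_eq_top_of_isKilling [FiniteDimensional K L] [IsKilling K L] :
    (derivedSeries K L 1).toSubmodule = ⊤ := by
  have hnd := IsKilling.killingForm_nondegenerate K L
  rw [← Submodule.dualAnnihilator_eq_bot_iff, Submodule.eq_bot_iff]
  intro f hf
  rw [Submodule.mem_dualAnnihilator] at hf
  obtain ⟨t, ht⟩ := ((killingForm K L).toDual hnd).surjective f
  have ht' : ∀ w, killingForm K L t w = f w := fun w ↦ by
    rw [← ht, LinearMap.BilinForm.toDual_def]
  have hc : t ∈ LieAlgebra.center K L := by
    rw [LieModule.mem_maxTrivSubmodule]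
    intro x
    apply hnd.1
    intro y
    rw [← lie_skew, map_neg, LinearMap.neg_apply, LieModule.traceForm_apply_lie_apply, ht',
      hf _ (lie_mem_derivedSeries_one x y), neg_zero]
  rw [LieAlgebra.center_eq_bot, LieSubmodule.mem_bot] at hc
  rw [← ht, hc, map_zero]

variable [FiniteDimensional K L]

theorem hasTrivialRadical_quotient_center [HasCentralRadical K L] :
    HasTrivialRadical K (L ⧸ LieAlgebra.center K L) := by
  rw [hasTrivialRadical_iff_no_abelian_ideals]
  intro J hJ
  let π : L →ₗ⁅K⁆ (L ⧸ LieAlgebra.center K L) :=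
    { LieSubmodule.Quotient.mk' (LieAlgebra.center K L) with
      map_lie' := fun {x y} ↦ LieSubmodule.Quotient.mk_bracket _ x y }
  have hπ : ∀ x, π x = 0 ↔ x ∈ LieAlgebra.center K L := fun x ↦
    LieSubmodule.Quotient.mk_eq_zero (N := LieAlgebra.center K L)
  let I : LieIdeal K L := J.comap π
  have h1 : ⁅I, I⁆ ≤ LieAlgebra.center K L := by
    rw [LieSubmodule.lieIdeal_oper_eq_span, LieSubmodule.lieSpan_le]
    rintro _ ⟨⟨x, hx⟩, ⟨y, hy⟩, rfl⟩
    rw [LieIdeal.mem_comap] at hx hy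
    have := hJ.trivial ⟨π x, hx⟩ ⟨π y, hy⟩
    have h2 : ⁅π x, π y⁆ = 0 := congrArg Subtype.val this
    rw [← LieHom.map_lie] at h2
    exact (hπ _).1 h2
  have hI : IsSolvable I := by
    refine IsSolvable.mk (R := K) (k := 2) ?_
    rw [LieIdeal.derivedSeries_eq_bot_iff, derivedSeriesOfIdeal_succ, derivedSeriesOfIdeal_succ,
      derivedSeriesOfIdeal_zero, eq_bot_iff, LieSubmodule.lieIdeal_oper_eq_span,
      LieSubmodule.lieSpan_le]
    rintro _ ⟨⟨x, hx⟩, ⟨y, hy⟩, rfl⟩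
    have := (LieModule.mem_maxTrivSubmodule (R := K) (L := L) (M := L) y).1 (h1 hy) x
    simpa using this
  rw [LieIdeal.solvable_iff_le_radical, HasCentralRadical.radical_eq_center] at hI
  rw [eq_bot_iff]
  intro x hx
  obtain ⟨y, rfl⟩ := LieSubmodule.Quotient.surjective_mk' _ x
  have hy : y ∈ I := hx
  exact (hπ y).2 (hI hy)

/-- The derived algebra of a reductive Lie algebra meets the centre trivially. For a linear form
`f`, the alternating form `(x, y) ↦ f ⁅x, y⁆` lives on the semisimple quotient by the centre, and
corresponds under the Killing form of this quotient to a derivation. That derivation is inner, so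
`f` agrees on the derived algebra with a linear form that factors through the quotient. -/
theorem eq_zero_of_mem_center_of_mem_derivedSeries_one [CharZero K] [HasCentralRadical K L] {z : L}
    (hz : z ∈ LieAlgebra.center K L) (hz' : z ∈ derivedSeries K L 1) : z = 0 := by
  have := hasTrivialRadical_quotient_center (K := K) (L := L)
  set Q := L ⧸ LieAlgebra.center K L
  have hnd := IsKilling.killingForm_nondegenerate K Q
  let π : L →ₗ⁅K⁆ Q :=
    { LieSubmodule.Quotient.mk' (LieAlgebra.center K L) with
      map_lie' := fun {x y} ↦ LieSubmodule.Quotient.mk_bracket _ x y }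
  have hπ : ∀ x, π x = 0 ↔ x ∈ LieAlgebra.center K L := fun x ↦
    LieSubmodule.Quotient.mk_eq_zero (N := LieAlgebra.center K L)
  have hsurj : Function.Surjective π := LieSubmodule.Quotient.surjective_mk' _
  obtain ⟨σ, hσ⟩ := (π : L →ₗ[K] Q).exists_rightInverse_of_surjective
    (LinearMap.range_eq_top.2 hsurj)
  replace hσ : ∀ x, π (σ x) = x := fun x ↦ LinearMap.congr_fun hσ x
  have hcen : ∀ a b : L, π a = π b → ∀ c : L, ⁅a, c⁆ = ⁅b, c⁆ := by
    intro a b hab c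
    have : a - b ∈ LieAlgebra.center K L := by rw [← hπ, map_sub, hab, sub_self]
    have := (LieModule.mem_maxTrivSubmodule (R := K) (L := L) (M := L) _).1 this c
    rw [← lie_skew, neg_eq_zero, sub_lie, sub_eq_zero] at this
    exact this
  have hcen' : ∀ a b : L, π a = π b → ∀ c : L, ⁅c, a⁆ = ⁅c, b⁆ := by
    intro a b hab c
    rw [← lie_skew, hcen a b hab, lie_skew]
  rw [← Module.forall_dual_apply_eq_zero_iff K]
  intro f
  let ω : Q →ₗ[K] Module.Dual K Q :=
    LinearMap.mk₂ K (fun x y ↦ f ⁅σ x, σ y⁆) (by intros; simp) (by intros; simp)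
      (by intros; simp) (by intros; simp)
  let B := (killingForm K Q).toDual hnd
  let d : Q →ₗ[K] Q := B.symm.toLinearMap ∘ₗ ω
  have hd : ∀ x y, killingForm K Q (d x) y = f ⁅σ x, σ y⁆ := by
    intro x y
    rw [← LinearMap.BilinForm.toDual_def (b := hnd)]
    simp [d, B, ω]
  have hσl : ∀ x y, π (σ ⁅x, y⁆) = π ⁅σ x, σ y⁆ := by
    intro x y; rw [hσ, LieHom.map_lie, hσ, hσ]
  let D : LieDerivation K Q Q :=
    { d with
      leibniz' := by
        intro a b
        change d ⁅a, b⁆ = ⁅a, d b⁆ - ⁅b, d a⁆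
        rw [← sub_eq_zero]
        apply hnd.1
        intro w
        rw [← lie_skew a (d b), ← lie_skew b (d a)]
        simp only [map_sub, map_neg, LinearMap.sub_apply, LinearMap.neg_apply,
          LieModule.traceForm_apply_lie_apply]
        change killingForm K Q _ _ - (- killingForm K Q _ _ - - killingForm K Q _ _) = 0
        rw [hd, hd, hd, hcen _ _ (hσl _ _), hcen' _ _ (hσl _ _), hcen' _ _ (hσl _ _),
          lie_lie, map_sub]
        ring }
  obtain ⟨t, ht⟩ := LieDerivation.IsKilling.exists_eq_ad D
  have hdt : ∀ x, d x = ⁅t, x⁆ := fun x ↦ by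
    rw [← LieDerivation.ad_apply_apply (R := K), ht]; rfl
  have key : ∀ a b : L, f ⁅a, b⁆ = killingForm K Q t (π ⁅a, b⁆) := by
    intro a b
    rw [LieHom.map_lie, ← LieModule.traceForm_apply_lie_apply, ← hdt]
    change _ = killingForm K Q _ _
    rw [hd, hcen _ a (hσ _), hcen' _ b (hσ _)]
  let f' : L →ₗ[K] K := f - (killingForm K Q t) ∘ₗ (π : L →ₗ[K] Q)
  have h0 : z ∈ LinearMap.ker f' := by
    refine derivedSeries_one_le (fun a b ↦ ?_) hz'
    simpa [f', sub_eq_zero] using key a b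
  have h1 : f z - killingForm K Q t (π z) = 0 := h0
  rwa [(hπ z).2 hz, map_zero, sub_zero] at h1

theorem exists_center_add_derivedSeries_one [CharZero K] [HasCentralRadical K L] (x : L) :
    ∃ z ∈ LieAlgebra.center K L, ∃ y ∈ derivedSeries K L 1, z + y = x := by
  have := hasTrivialRadical_quotient_center (K := K) (L := L)
  let π := LieSubmodule.Quotient.mk' (LieAlgebra.center K L)
  have hπ : ∀ x, π x = 0 ↔ x ∈ LieAlgebra.center K L := fun x ↦
    LieSubmodule.Quotient.mk_eq_zero (N := LieAlgebra.center K L)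
  have h1 : (derivedSeries K (L ⧸ LieAlgebra.center K L) 1).toSubmodule ≤
      (derivedSeries K L 1).toSubmodule.map (π : L →ₗ[K] _) := by
    refine derivedSeries_one_le fun a b ↦ ?_
    obtain ⟨a, rfl⟩ := LieSubmodule.Quotient.surjective_mk' _ a
    obtain ⟨b, rfl⟩ := LieSubmodule.Quotient.surjective_mk' _ b
    exact ⟨⁅a, b⁆, lie_mem_derivedSeries_one a b, LieSubmodule.Quotient.mk_bracket _ a b⟩
  rw [derivedSeries_one_eq_top_of_isKilling] at h1
  obtain ⟨y, hy, hyx⟩ := h1 (Submodule.mem_top (x := π x))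
  refine ⟨x - y, ?_, y, hy, sub_add_cancel _ _⟩
  rw [← hπ, map_sub, sub_eq_zero]
  exact hyx.symm

theorem isSemisimple_derivedSeries_one [CharZero K] [HasCentralRadical K L] :
    LieAlgebra.IsSemisimple K (derivedSeries K L 1) := by
  suffices HasTrivialRadical K (derivedSeries K L 1) by infer_instance
  rw [hasTrivialRadical_iff_no_abelian_ideals]
  intro I hI
  -- An ideal of the derived algebra is an ideal of `L`, as the centre acts trivially.
  let J : LieIdeal K L :=
    { I.toSubmodule.map (derivedSeries K L 1).toSubmodule.subtype with
      lie_mem := by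
        rintro x _ ⟨m, hm, rfl⟩
        obtain ⟨z, hz, y, hy, rfl⟩ := exists_center_add_derivedSeries_one (K := K) x
        have h0 := (LieModule.mem_maxTrivSubmodule (R := K) (L := L) (M := L) z).1 hz (m : L)
        rw [← lie_skew, neg_eq_zero] at h0
        refine ⟨⁅(⟨y, hy⟩ : derivedSeries K L 1), m⁆, I.lie_mem hm, ?_⟩
        change ⁅y, (m : L)⁆ = ⁅z + y, (m : L)⁆
        rw [add_lie, h0, zero_add] }
  have hJ : IsSolvable J := by
    refine IsSolvable.mk (R := K) (k := 1) ?_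
    rw [LieIdeal.derivedSeries_eq_bot_iff, derivedSeriesOfIdeal_succ,
      derivedSeriesOfIdeal_zero, eq_bot_iff, LieSubmodule.lieIdeal_oper_eq_span,
      LieSubmodule.lieSpan_le]
    rintro _ ⟨⟨_, a, ha, rfl⟩, ⟨_, b, hb, rfl⟩, rfl⟩
    have := hI.trivial ⟨a, ha⟩ ⟨b, hb⟩
    have h2 := congrArg (fun u : I ↦ ((u : derivedSeries K L 1) : L)) this
    have h3 : ⁅(a : L), (b : L)⁆ = 0 := h2
    exact h3
  rw [LieIdeal.solvable_iff_le_radical, HasCentralRadical.radical_eq_center] at hJ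
  rw [eq_bot_iff]
  intro x hx
  have : (x : L) ∈ J := ⟨x, hx, rfl⟩
  exact Subtype.ext (eq_zero_of_mem_center_of_mem_derivedSeries_one (hJ this) x.2)

/-- A maximal semisimple ideal of a reductive Lie algebra is the derived algebra. -/
theorem eq_derivedSeries_one_of_maximal [CharZero K] [HasCentralRadical K L] (I : LieIdeal K L)
    [LieAlgebra.IsSemisimple K I]
    (hI : ∀ J : LieIdeal K L, LieAlgebra.IsSemisimple K J → I ≤ J → J = I) :
    I = derivedSeries K L 1 := by
  refine (hI _ isSemisimple_derivedSeries_one ?_).symm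
  have h1 : (derivedSeries K I 1).toSubmodule ≤
      (derivedSeries K L 1).toSubmodule.comap I.toSubmodule.subtype :=
    derivedSeries_one_le fun a b ↦ lie_mem_derivedSeries_one (a : L) (b : L)
  rw [derivedSeries_one_eq_top_of_isKilling] at h1
  intro x hx
  exact h1 (Submodule.mem_top (x := (⟨x, hx⟩ : I)))

end ReductiveDecomposition

/-! ### Derivations of an algebra that splits off its centre -/

section SplitCenter

variable {K p q : Type*} [Field K] [LieRing p] [LieAlgebra K p] [LieRing q] [LieAlgebra K q]

/-- The projections of `q = Z(q) ⊕ ι(p)` onto its two summands. -/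
theorem exists_projections (ι : p →ₗ⁅K⁆ q) (hι : Function.Injective ι)
    (hc : IsCompl (LieAlgebra.center K q).toSubmodule (LinearMap.range (ι : p →ₗ[K] q))) :
    ∃ (ζ : q →ₗ[K] LieAlgebra.center K q) (π : q →ₗ[K] p),
      (∀ y, (ζ y : q) + ι (π y) = y) ∧ (∀ z : LieAlgebra.center K q, ζ z = z) ∧
      (∀ z : LieAlgebra.center K q, π z = 0) ∧ (∀ w, ζ (ι w) = 0) ∧ ∀ w, π (ι w) = w := by
  let e := LinearEquiv.ofInjective (ι : p →ₗ[K] q) hι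
  let ζ : q →ₗ[K] LieAlgebra.center K q := Submodule.projectionOnto _ _ hc
  let π' := Submodule.projectionOnto _ _ hc.symm
  have he : ∀ w, (e w : q) = ι w := fun w ↦ rfl
  have he' : ∀ u, ι (e.symm u) = (u : q) := fun u ↦ by rw [← he, e.apply_symm_apply]
  refine ⟨ζ, e.symm.toLinearMap ∘ₗ π', fun y ↦ ?_, fun z ↦ ?_, fun z ↦ ?_, fun w ↦ ?_, fun w ↦ ?_⟩
  · change (ζ y : q) + ι (e.symm (π' y)) = y
    rw [he']
    exact Submodule.projection_add_projection_eq_self hc y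
  · exact Submodule.projectionOnto_apply_left hc z
  · change e.symm (π' z) = 0
    rw [LinearEquiv.map_eq_zero_iff]
    exact (Submodule.projectionOnto_apply_eq_zero_iff hc.symm).2 z.2
  · exact (Submodule.projectionOnto_apply_eq_zero_iff hc).2 ⟨w, rfl⟩
  · change e.symm (π' (ι w)) = w
    rw [LinearEquiv.symm_apply_eq]
    exact Submodule.projectionOnto_apply_left hc.symm (e w)

/-- The derivation `y ↦ f y + ⁅x, y⁆`, where `f` is a linear map into the centre that kills the
derived algebra. -/
def centralAddInner (f : (q ⧸ (derivedSeries K q 1).toSubmodule) →ₗ[K] LieAlgebra.center K q)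
    (x : q) : LieDerivation K q q where
  toLinearMap := (LieAlgebra.center K q).toSubmodule.subtype ∘ₗ f ∘ₗ
    (derivedSeries K q 1).toSubmodule.mkQ + LieAlgebra.ad K q x
  leibniz' a b := by
    have hz : ∀ (z : LieAlgebra.center K q) (c : q), ⁅c, (z : q)⁆ = 0 := fun z ↦
      (LieModule.mem_maxTrivSubmodule (R := K) (L := q) (M := q) _).1 z.2
    have hm : (derivedSeries K q 1).toSubmodule.mkQ ⁅a, b⁆ = 0 :=
      (Submodule.Quotient.mk_eq_zero _).2 (lie_mem_derivedSeries_one a b)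
    simp only [LinearMap.add_apply, LinearMap.comp_apply, hm, map_zero, zero_add, lie_add,
      Submodule.subtype_apply, LieAlgebra.ad_apply]
    rw [hz, hz, zero_add, zero_add, leibniz_lie x a b, ← lie_skew ⁅x, a⁆ b]
    abel

theorem centralAddInner_apply
    (f : (q ⧸ (derivedSeries K q 1).toSubmodule) →ₗ[K] LieAlgebra.center K q) (x y : q) :
    centralAddInner f x y = f ((derivedSeries K q 1).toSubmodule.mkQ y) + ⁅x, y⁆ := rfl

variable [FiniteDimensional K q]

/-- If `q = Z(q) ⊕ p`, where `p` has trivial centre and only inner derivations, then a derivation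
of `q` is uniquely the sum of a linear map `q / [q, q] → Z(q)` and of `ad x` with `x ∈ p`. -/
theorem finrank_lieDerivation_of_isCompl_center (ι : p →ₗ⁅K⁆ q) (hι : Function.Injective ι)
    (hc : IsCompl (LieAlgebra.center K q).toSubmodule (LinearMap.range (ι : p →ₗ[K] q)))
    (hcenter : ∀ x : p, (∀ y : p, ⁅x, y⁆ = 0) → x = 0)
    (hinner : ∀ D : LieDerivation K p p, ∃ x : p, ∀ y, D y = ⁅x, y⁆) :
    Module.finrank K (LieDerivation K q q) =
      (Module.finrank K (LieAlgebra.center K q) +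
          Module.finrank K (p ⧸ (derivedSeries K p 1).toSubmodule)) *
        Module.finrank K (LieAlgebra.center K q) + Module.finrank K p := by
  have : FiniteDimensional K p := FiniteDimensional.of_injective (ι : p →ₗ[K] q) hι
  obtain ⟨ζ, π, hsum, hζ, hπ, hζι, hπι⟩ := exists_projections ι hι hc
  have hz : ∀ (z : LieAlgebra.center K q) (c : q), ⁅c, (z : q)⁆ = 0 := fun z ↦
    (LieModule.mem_maxTrivSubmodule (R := K) (L := q) (M := q) _).1 z.2
  have hz' : ∀ (z : LieAlgebra.center K q) (c : q), ⁅(z : q), c⁆ = 0 := fun z c ↦ by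
    rw [← lie_skew, hz, neg_zero]
  have hlie : ∀ a b : q, ⁅a, b⁆ = ι ⁅π a, π b⁆ := by
    intro a b
    conv_lhs => rw [← hsum a, ← hsum b]
    rw [add_lie, lie_add, lie_add, hz', hz', hz, zero_add, zero_add, zero_add, LieHom.map_lie]
  let Ψ : ((q ⧸ (derivedSeries K q 1).toSubmodule) →ₗ[K] LieAlgebra.center K q) × p →ₗ[K]
      LieDerivation K q q :=
    { toFun := fun u ↦ centralAddInner u.1 (ι u.2)
      map_add' := fun u v ↦ by
        ext y
        simp only [LieDerivation.add_apply, centralAddInner_apply, Prod.fst_add, Prod.snd_add,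
          LinearMap.add_apply, map_add, add_lie, LieSubmodule.coe_add]
        abel
      map_smul' := fun c u ↦ by
        ext y
        simp [LieDerivation.smul_apply, centralAddInner_apply] }
  have hΨ : ∀ f x y, Ψ (f, x) y = f ((derivedSeries K q 1).toSubmodule.mkQ y) + ⁅ι x, y⁆ :=
    fun _ _ _ ↦ rfl
  have hinj : Function.Injective Ψ := by
    rw [injective_iff_map_eq_zero]
    rintro ⟨f, x⟩ h
    have h0 : ∀ y, (f ((derivedSeries K q 1).toSubmodule.mkQ y) : q) + ι ⁅x, π y⁆ = 0 := by
      intro y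
      have := LieDerivation.congr_fun h y
      rwa [hΨ, hlie, hπι] at this
    have h1 : f = 0 := by
      refine LinearMap.ext fun y ↦ ?_
      obtain ⟨y, rfl⟩ := Submodule.mkQ_surjective _ y
      have := congrArg ζ (h0 y)
      rwa [map_add, hζ, hζι, add_zero, map_zero] at this
    have h2 : x = 0 := by
      refine hcenter x fun w ↦ ?_
      have := congrArg π (h0 (ι w))
      rwa [map_add, hπ, hπι, hπι, zero_add, map_zero] at this
    rw [h1, h2]; rfl
  have hsurj : Function.Surjective Ψ := by
    intro D
    have hDl : ∀ a b, D ⁅a, b⁆ = ι (⁅π a, π (D b)⁆ + ⁅π (D a), π b⁆) := by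
      intro a b
      rw [LieDerivation.apply_lie_eq_add, hlie, hlie (D a), map_add]
    let D' : LieDerivation K p p :=
      { toLinearMap := π ∘ₗ (D : q →ₗ[K] q) ∘ₗ (ι : p →ₗ[K] q)
        leibniz' := fun a b ↦ by
          change π (D (ι ⁅a, b⁆)) = ⁅a, π (D (ι b))⁆ - ⁅b, π (D (ι a))⁆
          rw [LieHom.map_lie, hDl, hπι, hπι, hπι, ← lie_skew b, sub_neg_eq_add] }
    obtain ⟨x, hx⟩ := hinner D'
    replace hx : ∀ w, π (D (ι w)) = ⁅x, w⁆ := hx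
    have hker : (derivedSeries K q 1).toSubmodule ≤ LinearMap.ker (ζ ∘ₗ (D : q →ₗ[K] q)) := by
      refine derivedSeries_one_le fun a b ↦ ?_
      change ζ (D ⁅a, b⁆) = 0
      rw [hDl, hζι]
    refine ⟨(Submodule.liftQ _ _ hker, x), ?_⟩
    ext y
    rw [hΨ, Submodule.mkQ_apply, Submodule.liftQ_apply, hlie, hπι]
    change (ζ (D y) : q) + ι ⁅x, π y⁆ = D y
    -- `D` preserves the centre, hence only the `p`-component of `y` contributes to `π (D y)`.
    have hDz : π (D (ζ y)) = 0 := by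
      refine hcenter _ fun w ↦ ?_
      have h1 := hDl (ζ y : q) (ι w)
      rw [hz', map_zero, hπ, zero_lie, zero_add, hπι] at h1
      exact (hι (by rw [map_zero]; exact h1.symm))
    have h2 : π (D y) = ⁅x, π y⁆ := by
      conv_lhs => rw [← hsum y]
      rw [map_add, map_add, hDz, zero_add, hx]
    rw [← h2, hsum]
  have e := LinearEquiv.ofBijective Ψ ⟨hinj, hsurj⟩
  rw [← e.finrank_eq, Module.finrank_prod, Module.finrank_linearMap]
  congr 2
  have hder : (derivedSeries K q 1).toSubmodule =
      (derivedSeries K p 1).toSubmodule.map (ι : p →ₗ[K] q) := by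
    refine le_antisymm (derivedSeries_one_le fun a b ↦ ?_) ?_
    · exact ⟨⁅π a, π b⁆, lie_mem_derivedSeries_one _ _, (hlie a b).symm⟩
    · rw [Submodule.map_le_iff_le_comap]
      refine derivedSeries_one_le fun a b ↦ ?_
      change ι ⁅a, b⁆ ∈ derivedSeries K q 1
      rw [LieHom.map_lie]
      exact lie_mem_derivedSeries_one _ _
  have h1 := Submodule.finrank_quotient_add_finrank (derivedSeries K q 1).toSubmodule
  have h2 := Submodule.finrank_quotient_add_finrank (derivedSeries K p 1).toSubmodule
  have h3 := Submodule.finrank_add_eq_of_isCompl hc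
  rw [LinearMap.finrank_range_of_inj hι] at h3
  have h4 : Module.finrank K (derivedSeries K p 1).toSubmodule =
      Module.finrank K (derivedSeries K q 1).toSubmodule := by
    rw [hder]
    exact ((derivedSeries K p 1).toSubmodule.equivMapOfInjective (ι : p →ₗ[K] q) hι).finrank_eq
  change Module.finrank K (LieAlgebra.center K q) + _ = _ at h3
  omega

end SplitCenter

/-! ### Root spaces and regular elements -/

section RootSpaces

set_option linter.unusedSectionVars false

variable {K L : Type*} [Field K] [CharZero K] [IsAlgClosed K] [LieRing L] [LieAlgebra K L]
  [FiniteDimensional K L] [LieAlgebra.IsSemisimple K L]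
  {H : LieSubalgebra K L} [H.IsCartanSubalgebra]

theorem root_ext {α β : H.root} (h : (α.1 : H → K) = β.1) : α = β :=
  Subtype.ext (DFunLike.coe_injective h)

/-- The root `-α`. -/
def negRoot (α : H.root) : H.root :=
  ⟨-α.1, by simpa using H.isNonZero_coe_root α⟩

@[simp] theorem coe_negRoot (α : H.root) : ((negRoot α).1 : H → K) = -(α.1 : H → K) :=
  rfl

@[simp] theorem negRoot_negRoot (α : H.root) : negRoot (negRoot α) = α :=
  root_ext (by simp)

theorem rootSystem_root_negRoot (α : H.root) :
    (rootSystem H).root (negRoot α) = -(rootSystem H).root α := by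
  ext x; simp [negRoot]

theorem rootSystem_root_eq_add_iff {α β γ : H.root} :
    (rootSystem H).root γ = (rootSystem H).root α + (rootSystem H).root β ↔
      (γ.1 : H → K) = α.1 + β.1 := by
  rw [LinearMap.ext_iff, funext_iff]
  rfl

theorem exists_ne_zero_mem_rootSpace (α : H.root) :
    ∃ x ∈ rootSpace H (α.1 : H → K), x ≠ 0 :=
  α.1.exists_ne_zero

/-- Root spaces are lines. -/
theorem exists_smul_eq_of_mem_rootSpace (α : H.root) {x y : L}
    (hx : x ∈ rootSpace H (α.1 : H → K)) (hx0 : x ≠ 0) (hy : y ∈ rootSpace H (α.1 : H → K)) :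
    ∃ c : K, c • x = y := by
  obtain ⟨c, hc⟩ := (finrank_eq_one_iff_of_nonzero' (⟨x, hx⟩ : rootSpace H (α.1 : H → K))
    (by simpa using hx0)).mp (finrank_rootSpace_eq_one _ (H.isNonZero_coe_root α)) ⟨y, hy⟩
  exact ⟨c, congrArg Subtype.val hc⟩

theorem lie_mem_rootSpace_of_eq_add {α β γ : H.root} (hγ : (γ.1 : H → K) = α.1 + β.1) {x y : L}
    (hx : x ∈ rootSpace H (α.1 : H → K)) (hy : y ∈ rootSpace H (β.1 : H → K)) :
    ⁅x, y⁆ ∈ rootSpace H (γ.1 : H → K) := by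
  rw [hγ]
  exact lie_mem_genWeightSpace_of_mem_genWeightSpace hx hy

/-- If `α + β` is a root then `⁅L_α, L_β⁆ ≠ 0`. The space `L_β` is spanned by `f ^ t` applied to a
highest vector of the `α`-string through `β`, with `t ≥ 1` as `α + β` is a root. By
`sl₂`-theory, `e` maps this vector to a nonzero multiple of `f ^ (t - 1)` applied to the highest
vector. -/
theorem lie_ne_zero_of_eq_add {α β γ : H.root} (hγ : (γ.1 : H → K) = α.1 + β.1) {x y : L}
    (hx : x ∈ rootSpace H (α.1 : H → K)) (hx0 : x ≠ 0)
    (hy : y ∈ rootSpace H (β.1 : H → K)) (hy0 : y ≠ 0) : ⁅x, y⁆ ≠ 0 := by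
  have hα := H.isNonZero_coe_root α
  obtain ⟨h, e, f, isSl2, he, hf⟩ := exists_isSl2Triple_of_weight_isNonZero hα
  obtain rfl := isSl2.h_eq_coroot hα he hf
  obtain ⟨v, hv, v_ne0⟩ := (LieModule.chainTop α.1 β.1).exists_ne_zero
  have prim : isSl2.HasPrimitiveVectorWith v (chainLength α.1 β.1 : K) :=
    have := lie_mem_genWeightSpace_of_mem_genWeightSpace he hv
    ⟨v_ne0, (chainLength_smul _ _ hv).symm, by
      rwa [LieModule.genWeightSpace_add_chainTop _ _ hα] at this⟩
  have ht : 1 ≤ LieModule.chainTopCoeff (α.1 : H → K) β.1 := by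
    have h1 := ((rootSpace_zsmul_add_ne_bot_iff α.1 β.1 hα 1).1
      (by rw [one_smul, ← hγ]; exact γ.1.2)).1
    exact_mod_cast h1
  have htN := chainTopCoeff_le_chainLength α.1 β.1
  obtain ⟨t, ht'⟩ : ∃ t, LieModule.chainTopCoeff (α.1 : H → K) β.1 = t + 1 :=
    ⟨_, (Nat.sub_add_cancel ht).symm⟩
  have hu : ((LieModule.toEnd K L L f) ^ (t + 1)) v ∈ rootSpace H (β.1 : H → K) := by
    have := toEnd_pow_apply_mem hf hv (t + 1)
    rwa [LieModule.coe_chainTop', ht', smul_neg, neg_add_cancel_left] at this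
  have hlt : t < chainLength α.1 β.1 := by omega
  have h2 := prim.lie_e_pow_succ_toEnd_f t
  have h3 := prim.pow_toEnd_f_ne_zero_of_eq_nat rfl hlt.le
  obtain ⟨c, hc⟩ := exists_smul_eq_of_mem_rootSpace β hy hy0 hu
  obtain ⟨a, ha⟩ := exists_smul_eq_of_mem_rootSpace α hx hx0 he
  intro h0
  rw [← hc, ← ha, smul_lie, lie_smul, h0, smul_zero, smul_zero, eq_comm, smul_eq_zero] at h2
  refine h2.elim (fun h4 ↦ mul_ne_zero ?_ ?_ h4) h3
  · exact Nat.cast_add_one_ne_zero t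
  · rw [sub_ne_zero]
    exact_mod_cast hlt.ne'

/-- For suitable `e ∈ L_α` and `f ∈ L_{-α}`, the bracket `⁅e, f⁆` is the nonzero element `t_α` of
the Cartan subalgebra that represents `α` under the Killing form. -/
theorem exists_lie_eq_cartanEquivDual_symm (α : H.root) :
    ∃ e ∈ rootSpace H (α.1 : H → K), ∃ f ∈ rootSpace H (-(α.1 : H → K)),
      ⁅e, f⁆ = ((cartanEquivDual H).symm α.1 : L) ∧ ((cartanEquivDual H).symm α.1 : L) ≠ 0 := by
  have hα := H.isNonZero_coe_root α
  obtain ⟨h, e, f, isSl2, he, hf⟩ := exists_isSl2Triple_of_weight_isNonZero hα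
  have h1 := lie_eq_killingForm_smul_of_mem_rootSpace_of_mem_rootSpace_neg he hf
  have h0 : ⁅e, f⁆ ≠ 0 := by rw [isSl2.lie_e_f]; exact isSl2.h_ne_zero
  have hk : killingForm K L e f ≠ 0 := by
    intro hk; rw [hk, zero_smul] at h1; exact h0 h1
  refine ⟨(killingForm K L e f)⁻¹ • e, Submodule.smul_mem _ _ he, f, hf, ?_, ?_⟩
  · rw [smul_lie, h1, smul_smul, inv_mul_cancel₀ hk, one_smul]
  · intro h; rw [h, smul_zero] at h1; exact h0 h1

theorem exists_regular (H : LieSubalgebra K L) [H.IsCartanSubalgebra] :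
    ∃ h : H, ∀ α : H.root, α.1 h ≠ 0 := by
  obtain ⟨h, hh⟩ := Module.Dual.exists_forall_ne_zero_of_forall_exists
    (fun α : H.root ↦ (rootSystem H).root α) (fun α ↦ by
      by_contra! hc
      exact (rootSystem H).ne_zero α (LinearMap.ext hc))
  exact ⟨h, hh⟩

/-- A subalgebra that contains a Cartan subalgebra is the sum of it and of root spaces. -/
theorem eq_cartanAddRootSpaces_of_le {p : LieSubalgebra K L} (hp : H ≤ p) :
    p.toSubmodule = cartanAddRootSpaces H
      {α : H.root | (rootSpace H (α.1 : H → K)).toSubmodule ≤ p.toSubmodule} := by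
  let N : LieSubmodule K H L :=
    { p.toSubmodule with lie_mem := fun {x m} hm ↦ p.lie_mem (hp x.2) hm }
  refine le_antisymm ?_ (sup_le hp (iSup₂_le fun α hα ↦ hα))
  have h1 : N.toSubmodule =
      ⨆ χ : LieModule.Weight K H L, (N ⊓ LieModule.genWeightSpace L χ).toSubmodule := by
    conv_lhs => rw [LieModule.eq_iSup_inf_genWeightSpace (N := N)]
    rw [LieSubmodule.iSup_toSubmodule]
  change N.toSubmodule ≤ _
  rw [h1]
  refine iSup_le fun χ ↦ ?_
  by_cases hχ : χ.IsZero
  · refine le_sup_of_le_left ?_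
    rintro x ⟨-, hx⟩
    have hx' : x ∈ LieModule.genWeightSpace L (χ : H → K) := hx
    rw [hχ.eq] at hx'
    simpa using hx'
  · refine le_sup_of_le_right ?_
    let α : H.root := ⟨χ, by simpa using hχ⟩
    rintro x ⟨hxp, hx⟩
    by_cases hx0 : x = 0
    · rw [hx0]; exact Submodule.zero_mem _
    have hα : (rootSpace H (α.1 : H → K)).toSubmodule ≤ p.toSubmodule := by
      intro y hy
      obtain ⟨c, rfl⟩ := exists_smul_eq_of_mem_rootSpace α hx hx0 hy
      exact Submodule.smul_mem _ _ hxp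
    exact Submodule.mem_iSup_of_mem α (Submodule.mem_iSup_of_mem hα hx)

/-- The centralizer of a regular element of a Cartan subalgebra is the Cartan subalgebra: the
range of `ad h` contains all root spaces, so that its kernel is no larger than `H`. -/
theorem mem_of_lie_regular_eq_zero {h : H} (hh : ∀ α : H.root, α.1 h ≠ 0) {x : L}
    (hx : ⁅(h : L), x⁆ = 0) : x ∈ H := by
  let A := LieAlgebra.ad K L (h : L)
  have hker : H.toSubmodule ≤ LinearMap.ker A := by
    intro y hy
    have : ⁅h, (⟨y, hy⟩ : H)⁆ = 0 := trivial_lie_zero _ _ _ _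
    exact congrArg Subtype.val this
  have htop : H.toSubmodule ⊔ LinearMap.range A = ⊤ := by
    rw [eq_top_iff]
    have := eq_cartanAddRootSpaces_of_le (H := H) (p := ⊤) le_top
    rw [LieSubalgebra.top_toSubmodule] at this
    rw [this]
    refine sup_le le_sup_left (iSup₂_le fun α _ ↦ le_sup_of_le_right fun y hy ↦ ?_)
    refine ⟨(α.1 h)⁻¹ • y, ?_⟩
    have h1 : ⁅(h : L), y⁆ = α.1 h • y := lie_eq_smul_of_mem_rootSpace hy h
    rw [map_smul, LieAlgebra.ad_apply, h1, smul_smul, inv_mul_cancel₀ (hh α), one_smul]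
  have h1 := Submodule.finrank_add_le_finrank_add_finrank H.toSubmodule (LinearMap.range A)
  rw [htop, finrank_top, ← A.finrank_range_add_finrank_ker] at h1
  have h2 := Submodule.eq_of_le_of_finrank_le hker (by omega)
  have : x ∈ LinearMap.ker A := hx
  rwa [← h2] at this

/-- An element on which every `ad h`, for `h` in the Cartan subalgebra, has at most a Jordan block
of size two for the eigenvalue `α h` lies in the root space `L_α`. -/
theorem mem_rootSpace_of_sq {α : H → K} {x : L}
    (hx : ∀ h : H, ⁅(h : L), ⁅(h : L), x⁆ - α h • x⁆ = α h • (⁅(h : L), x⁆ - α h • x)) :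
    x ∈ rootSpace H α := by
  rw [LieModule.mem_genWeightSpace]
  intro h
  refine ⟨2, ?_⟩
  have := hx h
  rw [pow_two, Module.End.mul_apply]
  simp only [LinearMap.sub_apply, LieModule.toEnd_apply_apply, LinearMap.smul_apply,
    Module.End.one_apply]
  exact sub_eq_zero.2 this

end RootSpaces

/-! ### Positive roots and parabolic sets of roots -/

section PositiveRoots

set_option linter.unusedSectionVars false

variable {K L : Type*} [Field K] [CharZero K] [IsAlgClosed K] [LieRing L] [LieAlgebra K L]
  [FiniteDimensional K L] [LieAlgebra.IsSemisimple K L]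
  {H : LieSubalgebra K L} [H.IsCartanSubalgebra] {b : (rootSystem H).Base}

theorem mem_positiveRoots_of_mem_support {α : H.root} (hα : α ∈ b.support) :
    α ∈ positiveRoots H b :=
  AddSubmonoid.subset_closure ⟨α, hα, rfl⟩

theorem mem_positiveRoots_or_negRoot_mem (b : (rootSystem H).Base) (α : H.root) :
    α ∈ positiveRoots H b ∨ negRoot α ∈ positiveRoots H b := by
  refine (b.root_mem_or_neg_mem α).imp id fun h ↦ ?_
  rw [← rootSystem_root_negRoot] at h
  exact h

theorem coord_positiveRoots {α : H.root} (hα : α ∈ positiveRoots H b) (i : b.support) :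
    ∃ n : ℕ, b.toWeightBasis.repr ((rootSystem H).root α) i = n := by
  classical
  refine AddSubmonoid.closure_induction (motive := fun v _ ↦ ∃ n : ℕ, b.toWeightBasis.repr v i = n)
    ?_ ?_ ?_ hα
  · rintro _ ⟨j, hj, rfl⟩
    rw [b.toWeightBasis_repr_root ⟨j, hj⟩, Finsupp.single_apply]
    split_ifs
    · exact ⟨1, by simp⟩
    · exact ⟨0, by simp⟩
  · exact ⟨0, by simp⟩
  · rintro x y - - ⟨m, hm⟩ ⟨n, hn⟩
    exact ⟨m + n, by simp [hm, hn]⟩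

theorem negRoot_notMem_positiveRoots {α : H.root} (hα : α ∈ positiveRoots H b) :
    negRoot α ∉ positiveRoots H b := by
  intro hα'
  refine (rootSystem H).ne_zero α (b.toWeightBasis.repr.map_eq_zero_iff.1 (Finsupp.ext fun i ↦ ?_))
  obtain ⟨m, hm⟩ := coord_positiveRoots hα i
  obtain ⟨n, hn⟩ := coord_positiveRoots hα' i
  rw [rootSystem_root_negRoot, map_neg, Finsupp.neg_apply, hm, neg_eq_iff_add_eq_zero] at hn
  have : m = 0 := by
    have : m + n = 0 := by exact_mod_cast hn
    omega
  rw [hm, this]; simp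

/-- Every positive root is reached from a simple one by adding simple roots, all intermediate sums
being positive roots. -/
theorem positiveRoots_induction {P : H.root → Prop} {α : H.root} (hα : α ∈ positiveRoots H b)
    (simple : ∀ β ∈ b.support, P β)
    (add : ∀ β δ γ : H.root, (γ.1 : H → K) = β.1 + δ.1 → β ∈ positiveRoots H b → P β →
      δ ∈ b.support → P γ) : P α := by
  have key : ∀ β : H.root, b.IsPos β → β ∈ positiveRoots H b ∧ P β := fun β hβ ↦ by
    refine hβ.induction_on_add (p := fun β ↦ β ∈ positiveRoots H b ∧ P β)
      (fun β hβ ↦ ⟨mem_positiveRoots_of_mem_support hβ, simple β hβ⟩) ?_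
    rintro β δ γ hγ ⟨hβ, hPβ⟩ hδ
    refine ⟨?_, add β δ γ (rootSystem_root_eq_add_iff.1 hγ) hβ hPβ hδ⟩
    change _ ∈ AddSubmonoid.closure _
    rw [hγ]
    exact add_mem hβ (mem_positiveRoots_of_mem_support hδ)
  rcases RootPairing.Base.IsPos.or_neg b α with h | h
  · exact (key α h).2
  · refine absurd (key _ h).1 ?_
    have : (rootSystem H).reflectionPerm α α = negRoot α := by
      apply (rootSystem H).root.injective
      rw [rootSystem_root_negRoot, RootPairing.root_reflectionPerm,
        RootPairing.reflection_apply_self]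
    change (rootSystem H).reflectionPerm α α ∉ _
    rw [this]
    exact negRoot_notMem_positiveRoots hα

theorem mem_span_root_iff {D : Finset H.root} (hD : D ⊆ b.support) (v : Module.Dual K H) :
    v ∈ Submodule.span K ((rootSystem H).root '' D) ↔
      ∀ i : b.support, (i : H.root) ∉ D → b.toWeightBasis.repr v i = 0 := by
  have h1 : (rootSystem H).root '' (D : Set H.root) =
      b.toWeightBasis '' {i : b.support | (i : H.root) ∈ D} := by
    ext w
    constructor
    · rintro ⟨α, hα, rfl⟩
      exact ⟨⟨α, hD hα⟩, hα, by simp⟩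
    · rintro ⟨i, hi, rfl⟩
      exact ⟨i, hi, by simp⟩
  rw [h1, Module.Basis.mem_span_image]
  constructor
  · intro h i hi
    by_contra h0
    exact hi (h (Finsupp.mem_support_iff.2 h0))
  · intro h i hi
    by_contra h0
    exact Finsupp.mem_support_iff.1 hi (h i h0)

/-- A set of roots that contains the positive roots and is closed under addition of roots is
determined by the simple roots whose negatives it contains. -/
theorem eq_parabolicRoots_of_closed {S : Set H.root} (hpos : positiveRoots H b ⊆ S)
    (hS : ∀ α ∈ S, ∀ β ∈ S, ∀ γ : H.root, (γ.1 : H → K) = α.1 + β.1 → γ ∈ S)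
    {D : Finset H.root} (hD : ∀ α, α ∈ D ↔ α ∈ b.support ∧ negRoot α ∈ S) :
    S = parabolicRoots H b D := by
  have hDs : D ⊆ b.support := fun α hα ↦ ((hD α).1 hα).1
  have h1 : ∀ α ∈ positiveRoots H b,
      (rootSystem H).root α ∈ Submodule.span K ((rootSystem H).root '' D) → negRoot α ∈ S := by
    intro α hα
    refine positiveRoots_induction (P := fun α ↦ (rootSystem H).root α ∈
      Submodule.span K ((rootSystem H).root '' D) → negRoot α ∈ S) hα
      (fun β hβ hβD ↦ ?_) fun β δ γ hγ hβ ih hδ hγD ↦ ?_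
    · have := (mem_span_root_iff hDs _).1 hβD ⟨β, hβ⟩
      rw [b.toWeightBasis_repr_root ⟨β, hβ⟩, Finsupp.single_eq_same] at this
      by_contra hS
      exact one_ne_zero (this fun h ↦ hS ((hD β).1 h).2)
    · -- The coordinates of positive roots are natural numbers, so no cancellation occurs.
      have h2 : ∀ i : b.support, (i : H.root) ∉ D →
          b.toWeightBasis.repr ((rootSystem H).root β) i = 0 ∧
          b.toWeightBasis.repr ((rootSystem H).root δ) i = 0 := by
        intro i hi
        obtain ⟨m, hm⟩ := coord_positiveRoots hβ i
        obtain ⟨n, hn⟩ := coord_positiveRoots (mem_positiveRoots_of_mem_support hδ) i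
        have h3 := (mem_span_root_iff hDs _).1 hγD i hi
        rw [rootSystem_root_eq_add_iff.2 hγ, map_add, Finsupp.add_apply, hm, hn] at h3
        have : m + n = 0 := by exact_mod_cast h3
        rw [hm, hn, Nat.eq_zero_of_add_eq_zero_right this, Nat.eq_zero_of_add_eq_zero_left this]
        simp
      have hδD : δ ∈ D := by
        by_contra h
        have := (h2 ⟨δ, hδ⟩ h).2
        rw [b.toWeightBasis_repr_root ⟨δ, hδ⟩, Finsupp.single_eq_same] at this
        exact one_ne_zero this
      refine hS _ (ih ((mem_span_root_iff hDs _).2 fun i hi ↦ (h2 i hi).1)) _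
        ((hD δ).1 hδD).2 _ ?_
      rw [coe_negRoot, coe_negRoot, coe_negRoot, hγ, neg_add]
  have h2 : ∀ α ∈ positiveRoots H b, negRoot α ∈ S →
      (rootSystem H).root α ∈ Submodule.span K ((rootSystem H).root '' D) := by
    intro α hα
    refine positiveRoots_induction (P := fun α ↦ negRoot α ∈ S → (rootSystem H).root α ∈
      Submodule.span K ((rootSystem H).root '' D)) hα
      (fun β hβ hβS ↦ ?_) fun β δ γ hγ hβ ih hδ hγS ↦ ?_
    · exact Submodule.subset_span ⟨β, (hD β).2 ⟨hβ, hβS⟩, rfl⟩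
    · rw [rootSystem_root_eq_add_iff.2 hγ]
      have hδS : negRoot δ ∈ S := hS _ hγS _ (hpos hβ) _ (by
        rw [coe_negRoot, coe_negRoot, hγ]; abel)
      have hβS : negRoot β ∈ S := hS _ hγS _ (hpos (mem_positiveRoots_of_mem_support hδ)) _ (by
        rw [coe_negRoot, coe_negRoot, hγ]; abel)
      exact add_mem (ih hβS) (Submodule.subset_span ⟨δ, (hD δ).2 ⟨hδ, hδS⟩, rfl⟩)
  ext α
  constructor
  · intro hα
    rcases mem_positiveRoots_or_negRoot_mem b α with h | h
    · exact Or.inl h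
    · refine Or.inr ?_
      have := h2 _ h (by rwa [negRoot_negRoot])
      rw [rootSystem_root_negRoot, neg_mem_iff] at this
      exact this
  · rintro (hα | hα)
    · exact hpos hα
    rcases mem_positiveRoots_or_negRoot_mem b α with h | h
    · exact hpos h
    · rw [← negRoot_negRoot α]
      refine h1 _ h ?_
      rw [rootSystem_root_negRoot]
      exact neg_mem hα

theorem root_mem_span_of_mem_parabolicRoots {D : Finset H.root} {α : H.root}
    (hα : α ∈ parabolicRoots H b D) (hα' : negRoot α ∈ parabolicRoots H b D) :
    (rootSystem H).root α ∈ Submodule.span K ((rootSystem H).root '' D) := by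
  rcases hα with hα | hα
  · rcases hα' with h | h
    · exact absurd h (negRoot_notMem_positiveRoots hα)
    · have h2 : (rootSystem H).root (negRoot α) ∈
        Submodule.span K ((rootSystem H).root '' D) := h
      rwa [rootSystem_root_negRoot, neg_mem_iff] at h2
  · exact hα

theorem le_of_toSubmodule_eq {p : LieSubalgebra K L} {S : Set H.root}
    (hp : p.toSubmodule = cartanAddRootSpaces H S) :
    H ≤ p ∧ ∀ α ∈ S, ∀ x ∈ rootSpace H (α.1 : H → K), x ∈ p := by
  constructor
  · intro x hx
    change x ∈ p.toSubmodule
    rw [hp]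
    exact Submodule.mem_sup_left hx
  · intro α hα x hx
    change x ∈ p.toSubmodule
    rw [hp]
    exact Submodule.mem_sup_right
      (Submodule.mem_iSup_of_mem α (Submodule.mem_iSup_of_mem hα hx))

/-- A parabolic subalgebra is standard with respect to any Cartan subalgebra and any base of a
Borel subalgebra that it contains. -/
theorem IsParabolic.exists_isStandardParabolic {p : LieSubalgebra K L} (hp : IsParabolic p) :
    ∃ (H : LieSubalgebra K L) (_ : H.IsCartanSubalgebra) (b : (rootSystem H).Base)
      (D : Finset H.root), IsStandardParabolic H b D p := by
  classical
  obtain ⟨B, ⟨H, hH, b, hB⟩, hBp⟩ := hp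
  obtain ⟨hHB, hroot⟩ := le_of_toSubmodule_eq hB
  let S : Set H.root := {α | (rootSpace H (α.1 : H → K)).toSubmodule ≤ p.toSubmodule}
  refine ⟨H, hH, b, b.support.filter fun α ↦ negRoot α ∈ S, Finset.filter_subset _ _, ?_⟩
  have hpS : p.toSubmodule = cartanAddRootSpaces H S :=
    eq_cartanAddRootSpaces_of_le (hHB.trans hBp)
  have hS : ∀ α ∈ S, ∀ x ∈ rootSpace H (α.1 : H → K), x ∈ p := fun α hα x hx ↦
    (show (rootSpace H (α.1 : H → K)).toSubmodule ≤ p.toSubmodule from hα) hx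
  refine hpS.trans (congrArg _ (eq_parabolicRoots_of_closed (S := S)
    (fun α hα x hx ↦ hBp (hroot α hα x hx)) ?_ fun α ↦ Finset.mem_filter))
  intro α hα β hβ γ hγ z hz
  obtain ⟨x, hx, hx0⟩ := exists_ne_zero_mem_rootSpace α
  obtain ⟨y, hy, hy0⟩ := exists_ne_zero_mem_rootSpace β
  obtain ⟨c, rfl⟩ := exists_smul_eq_of_mem_rootSpace γ (lie_mem_rootSpace_of_eq_add hγ hx hy)
    (lie_ne_zero_of_eq_add hγ hx hx0 hy hy0) hz
  exact Submodule.smul_mem _ _ (p.lie_mem (hS α hα x hx) (hS β hβ y hy))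

end PositiveRoots

/-! ### Derivations of standard parabolic subalgebras -/

section StandardParabolic

variable {K L : Type*} [Field K] [CharZero K] [IsAlgClosed K] [LieRing L] [LieAlgebra K L]
  [FiniteDimensional K L] [LieAlgebra.IsSemisimple K L]
  {H : LieSubalgebra K L} [H.IsCartanSubalgebra] {b : (rootSystem H).Base}
  {p : LieSubalgebra K L} {S : Set H.root}

/-- A linear map on `H ∔ ∑_{α ∈ S} L_α` vanishes if it vanishes on `H` and on each `L_α`. -/
theorem linearMap_eq_zero_of_toSubmodule_eq (hp : p.toSubmodule = cartanAddRootSpaces H S)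
    {V : Type*} [AddCommGroup V] [Module K V] (f : p →ₗ[K] V)
    (hH : ∀ x : p, (x : L) ∈ H → f x = 0)
    (hroot : ∀ α ∈ S, ∀ x : p, (x : L) ∈ rootSpace H (α.1 : H → K) → f x = 0) (x : p) :
    f x = 0 := by
  obtain ⟨hHp, hSp⟩ := le_of_toSubmodule_eq hp
  have h1 : p.toSubmodule ≤ (LinearMap.ker f).map p.toSubmodule.subtype := by
    conv_lhs => rw [hp]
    refine sup_le (fun y hy ↦ ⟨⟨y, hHp hy⟩, hH _ hy, rfl⟩) (iSup₂_le fun α hα y hy ↦ ?_)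
    exact ⟨⟨y, hSp α hα y hy⟩, hroot α hα _ hy, rfl⟩
  obtain ⟨y, hy, hyx⟩ := h1 x.2
  rw [← Subtype.ext hyx]
  exact hy

theorem eq_zero_of_forall_positiveRoots {t : H} (b : (rootSystem H).Base)
    (ht : ∀ α ∈ positiveRoots H b, α.1 t = 0) : t = 0 := by
  have h1 : ∀ f : Module.Dual K H, f t = 0 := by
    intro f
    have h2 : f ∈ Submodule.span K ((rootSystem H).root '' b.support) := by
      rw [RootPairing.Base.span_root_support, RootPairing.rootSpan,
        RootPairing.IsRootSystem.span_root_eq_top]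
      exact Submodule.mem_top
    refine Submodule.span_induction ?_ rfl (fun f g _ _ hf hg ↦ ?_) (fun c f _ hf ↦ ?_) h2
    · rintro _ ⟨α, hα, rfl⟩
      exact ht α (mem_positiveRoots_of_mem_support hα)
    · rw [LinearMap.add_apply, hf, hg, add_zero]
    · rw [LinearMap.smul_apply, hf, smul_zero]
  exact (Module.forall_dual_apply_eq_zero_iff K t).1 h1

theorem eq_zero_of_forall_lie_eq_zero (hp : p.toSubmodule = cartanAddRootSpaces H S)
    (hS : positiveRoots H b ⊆ S) (x : p) (hx : ∀ y : p, ⁅x, y⁆ = 0) : x = 0 := by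
  obtain ⟨hHp, hSp⟩ := le_of_toSubmodule_eq hp
  have hx' : ∀ y ∈ p, ⁅(x : L), y⁆ = 0 := fun y hy ↦ congrArg Subtype.val (hx ⟨y, hy⟩)
  obtain ⟨h, hh⟩ := exists_regular H
  have hxH : (x : L) ∈ H := by
    refine mem_of_lie_regular_eq_zero hh ?_
    rw [← lie_skew, hx' _ (hHp h.2), neg_zero]
  have h0 : (⟨x, hxH⟩ : H) = 0 := by
    refine eq_zero_of_forall_positiveRoots b fun α hα ↦ ?_
    obtain ⟨e, he, he0⟩ := exists_ne_zero_mem_rootSpace α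
    have h1 : ⁅(x : L), e⁆ = α.1 ⟨x, hxH⟩ • e := lie_eq_smul_of_mem_rootSpace he ⟨x, hxH⟩
    rw [hx' _ (hSp α (hS hα) e he), eq_comm, smul_eq_zero] at h1
    exact h1.resolve_right he0
  exact Subtype.ext (congrArg (fun u : H ↦ (u : L)) h0)

/-- A derivation that maps a regular element of the Cartan subalgebra into the Cartan subalgebra
kills the Cartan subalgebra and preserves the root spaces. -/
theorem derivation_apply_of_regular (hp : p.toSubmodule = cartanAddRootSpaces H S)
    (hS : positiveRoots H b ⊆ S) (D : LieDerivation K p p) {h₀ : p} (hh₀ : (h₀ : L) ∈ H)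
    (hreg : ∀ α : H.root, α.1 ⟨h₀, hh₀⟩ ≠ 0) (hD₀ : (D h₀ : L) ∈ H) :
    (∀ x : p, (x : L) ∈ H → D x = 0) ∧
      ∀ α ∈ S, ∀ x : p, (x : L) ∈ rootSpace H (α.1 : H → K) →
        (D x : L) ∈ rootSpace H (α.1 : H → K) := by
  obtain ⟨hHp, hSp⟩ := le_of_toSubmodule_eq hp
  have hcomm : ∀ x ∈ H, ∀ y ∈ H, ⁅x, y⁆ = 0 := fun x hx y hy ↦
    congrArg Subtype.val (trivial_lie_zero _ _ (⟨x, hx⟩ : H) (⟨y, hy⟩ : H))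
  have hDl : ∀ x y : p, (D ⁅x, y⁆ : L) = ⁅(x : L), (D y : L)⁆ + ⁅(D x : L), (y : L)⁆ := fun x y ↦
    congrArg Subtype.val (LieDerivation.apply_lie_eq_add D x y)
  have hDH : ∀ x : p, (x : L) ∈ H → (D x : L) ∈ H := by
    intro x hx
    refine mem_of_lie_regular_eq_zero hreg ?_
    have h1 : ⁅h₀, x⁆ = 0 := Subtype.ext (hcomm _ hh₀ _ hx)
    have h2 := hDl h₀ x
    rw [h1, map_zero, hcomm _ hD₀ _ hx, add_zero] at h2
    exact h2.symm
  have key : ∀ α : H.root, ∀ x : p, (x : L) ∈ rootSpace H (α.1 : H → K) →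
      ∀ (h : p) (hh : (h : L) ∈ H),
      ⁅(h : L), (D x : L)⁆ - α.1 ⟨h, hh⟩ • (D x : L) = -α.1 ⟨D h, hDH h hh⟩ • (x : L) := by
    intro α x hx h hh
    have h1 : ⁅h, x⁆ = α.1 ⟨h, hh⟩ • x :=
      Subtype.ext (lie_eq_smul_of_mem_rootSpace hx ⟨h, hh⟩)
    have h2 : ⁅(D h : L), (x : L)⁆ = α.1 ⟨D h, hDH h hh⟩ • (x : L) :=
      lie_eq_smul_of_mem_rootSpace hx ⟨D h, hDH h hh⟩
    have h3 := hDl h x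
    rw [h1, h2, map_smul] at h3
    have h4 : α.1 ⟨h, hh⟩ • (D x : L) = ⁅(h : L), (D x : L)⁆ + α.1 ⟨D h, hDH h hh⟩ • (x : L) := h3
    rw [h4, neg_smul]
    abel
  have hroot : ∀ α : H.root, ∀ x : p, (x : L) ∈ rootSpace H (α.1 : H → K) →
      (D x : L) ∈ rootSpace H (α.1 : H → K) := by
    intro α x hx
    refine mem_rootSpace_of_sq fun h ↦ ?_
    rw [key α x hx ⟨h, hHp h.2⟩ h.2, lie_smul,
      show ⁅(h : L), (x : L)⁆ = α.1 h • (x : L) from lie_eq_smul_of_mem_rootSpace hx h, smul_comm]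
  refine ⟨fun x hx ↦ ?_, fun α _ ↦ hroot α⟩
  have h0 : (⟨D x, hDH x hx⟩ : H) = 0 := by
    refine eq_zero_of_forall_positiveRoots b fun α hα ↦ ?_
    obtain ⟨e, he, he0⟩ := exists_ne_zero_mem_rootSpace α
    have h1 := key α ⟨e, hSp α (hS hα) e he⟩ he x hx
    have h2 : ⁅(x : L), (D ⟨e, hSp α (hS hα) e he⟩ : L)⁆ = α.1 ⟨x, hx⟩ • _ :=
      lie_eq_smul_of_mem_rootSpace (hroot α ⟨e, hSp α (hS hα) e he⟩ he) ⟨x, hx⟩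
    rw [h2, sub_self, eq_comm, smul_eq_zero, neg_eq_zero] at h1
    exact h1.resolve_right he0
  exact Subtype.ext (congrArg (fun u : H ↦ (u : L)) h0)

/-- A derivation that kills the Cartan subalgebra and the simple root spaces, and preserves all root
spaces, is zero: the positive root spaces are generated by the simple ones, and `L_α` is dual to
`L_{-α}` under the bracket. -/
theorem derivation_apply_eq_zero (hp : p.toSubmodule = cartanAddRootSpaces H S)
    (hS : positiveRoots H b ⊆ S) (D : LieDerivation K p p)
    (hDH : ∀ x : p, (x : L) ∈ H → D x = 0)
    (hDroot : ∀ α ∈ S, ∀ x : p, (x : L) ∈ rootSpace H (α.1 : H → K) →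
        (D x : L) ∈ rootSpace H (α.1 : H → K))
    (hsimple : ∀ α ∈ b.support, ∀ x : p, (x : L) ∈ rootSpace H (α.1 : H → K) → D x = 0) (x : p) :
    D x = 0 := by
  obtain ⟨hHp, hSp⟩ := le_of_toSubmodule_eq hp
  have hpos : ∀ α ∈ positiveRoots H b, ∀ x : p, (x : L) ∈ rootSpace H (α.1 : H → K) → D x = 0 := by
    intro α hα
    refine positiveRoots_induction (P := fun α ↦ ∀ x : p, (x : L) ∈ rootSpace H (α.1 : H → K) →
      D x = 0) hα hsimple fun β δ γ hγ hβ ih hδ x hx ↦ ?_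
    obtain ⟨u, hu, hu0⟩ := exists_ne_zero_mem_rootSpace β
    obtain ⟨v, hv, hv0⟩ := exists_ne_zero_mem_rootSpace δ
    obtain ⟨c, hc⟩ := exists_smul_eq_of_mem_rootSpace γ (lie_mem_rootSpace_of_eq_add hγ hu hv)
      (lie_ne_zero_of_eq_add hγ hu hu0 hv hv0) hx
    let u' : p := ⟨u, hSp β (hS hβ) u hu⟩
    let v' : p := ⟨v, hSp δ (hS (mem_positiveRoots_of_mem_support hδ)) v hv⟩
    have h1 : x = c • ⁅u', v'⁆ := Subtype.ext hc.symm
    rw [h1, map_smul, LieDerivation.apply_lie_eq_add, ih u' hu, hsimple δ hδ v' hv, lie_zero,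
      zero_lie, add_zero, smul_zero]
  refine linearMap_eq_zero_of_toSubmodule_eq hp (D : p →ₗ[K] p) hDH (fun α hα x hx ↦ ?_) x
  rcases mem_positiveRoots_or_negRoot_mem b α with h | h
  · exact hpos α h x hx
  obtain ⟨e, he, f, hf, hef, hne⟩ := exists_lie_eq_cartanEquivDual_symm α
  rw [← hef] at hne
  have he0 : e ≠ 0 := by rintro rfl; exact hne (zero_lie f)
  rw [← coe_negRoot] at hf
  let e' : p := ⟨e, hSp α hα e he⟩
  let f' : p := ⟨f, hSp _ (hS h) f hf⟩
  obtain ⟨c, hc⟩ := exists_smul_eq_of_mem_rootSpace α he he0 (hDroot α hα e' he)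
  have h1 : D ⁅e', f'⁆ = 0 := hDH _ (by
    change ⁅e, f⁆ ∈ H
    rw [hef]; exact Subtype.property _)
  rw [LieDerivation.apply_lie_eq_add, hpos _ h f' hf, lie_zero, zero_add] at h1
  have h2 : ⁅(D e' : L), f⁆ = 0 := congrArg Subtype.val h1
  rw [← hc, smul_lie, smul_eq_zero] at h2
  have hDe : D e' = 0 := by
    refine Subtype.ext ?_
    rw [← hc, h2.resolve_right hne, zero_smul]; rfl
  obtain ⟨a, ha⟩ := exists_smul_eq_of_mem_rootSpace α he he0 hx
  have h3 : x = a • e' := Subtype.ext ha.symm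
  change D x = 0
  rw [h3, map_smul, hDe, smul_zero]

/-- All derivations of a subalgebra that contains a Borel subalgebra are inner. Modulo inner
derivations, `D` maps a regular element `h₀` of the Cartan subalgebra into the Cartan subalgebra; it
then acts on each root space by a scalar, and the scalars on the simple root spaces are those of
`ad t` for some `t` in the Cartan subalgebra. -/
theorem exists_derivation_eq_lie (hp : p.toSubmodule = cartanAddRootSpaces H S)
    (hS : positiveRoots H b ⊆ S) (D : LieDerivation K p p) : ∃ x : p, ∀ y, D y = ⁅x, y⁆ := by
  obtain ⟨hHp, hSp⟩ := le_of_toSubmodule_eq hp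
  obtain ⟨h, hreg⟩ := exists_regular H
  let h₀ : p := ⟨h, hHp h.2⟩
  have hdecomp : ∀ y : p, ∃ x : p, ((y - ⁅h₀, x⁆ : p) : L) ∈ H := by
    let N : Submodule K p := (H.toSubmodule.comap p.toSubmodule.subtype) ⊔
      LinearMap.range (LieAlgebra.ad K p h₀ : p →ₗ[K] p)
    have hN : ∀ y, N.mkQ y = 0 := by
      refine linearMap_eq_zero_of_toSubmodule_eq hp _ (fun y hy ↦ ?_) (fun α hα y hy ↦ ?_)
      · exact (Submodule.Quotient.mk_eq_zero _).2 (Submodule.mem_sup_left hy)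
      · refine (Submodule.Quotient.mk_eq_zero _).2 (Submodule.mem_sup_right
          ⟨(α.1 h)⁻¹ • y, ?_⟩)
        have h1 : ⁅h₀, y⁆ = α.1 h • y := Subtype.ext (lie_eq_smul_of_mem_rootSpace hy h)
        rw [map_smul, LieAlgebra.ad_apply, h1, smul_smul, inv_mul_cancel₀ (hreg α), one_smul]
    intro y
    obtain ⟨u, hu, _, ⟨x, rfl⟩, hux⟩ :=
      Submodule.mem_sup.1 ((Submodule.Quotient.mk_eq_zero _).1 (hN y))
    refine ⟨x, ?_⟩
    rw [← hux, LieAlgebra.ad_apply, add_sub_cancel_right]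
    exact hu
  obtain ⟨x, hx⟩ := hdecomp (D h₀)
  let D₁ : LieDerivation K p p := D + LieDerivation.ad K p x
  have hD₁ : ∀ y, D₁ y = D y + ⁅x, y⁆ := fun y ↦ by
    rw [LieDerivation.add_apply, LieDerivation.ad_apply_apply]
  obtain ⟨hD₁H, hD₁root⟩ := derivation_apply_of_regular hp hS D₁ (h₀ := h₀) h.2 hreg (by
    rw [hD₁, ← lie_skew, ← sub_eq_add_neg]; exact hx)
  have hscalar : ∀ α : b.support, ∃ c : K, ∀ y : p, (y : L) ∈ rootSpace H (α.1.1 : H → K) →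
      D₁ y = c • y := by
    rintro ⟨α, hα⟩
    have hαS := hS (mem_positiveRoots_of_mem_support hα)
    obtain ⟨e, he, he0⟩ := exists_ne_zero_mem_rootSpace α
    let e' : p := ⟨e, hSp α hαS e he⟩
    obtain ⟨c, hc⟩ := exists_smul_eq_of_mem_rootSpace α he he0 (hD₁root α hαS e' he)
    have hc' : D₁ e' = c • e' := Subtype.ext hc.symm
    refine ⟨c, fun y hy ↦ ?_⟩
    obtain ⟨a, ha⟩ := exists_smul_eq_of_mem_rootSpace α he he0 hy
    have h3 : y = a • e' := Subtype.ext ha.symm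
    rw [h3, map_smul, hc', smul_comm]
  choose c hc using hscalar
  let t : H := (Module.evalEquiv K H).symm (b.toWeightBasis.constr K c)
  have ht : ∀ α : b.support, α.1.1 t = c α := by
    intro α
    have h1 : (rootSystem H).root α t = b.toWeightBasis.constr K c ((rootSystem H).root α) :=
      Module.apply_evalEquiv_symm_apply _ _ _ _
    rw [← b.toWeightBasis_apply α, Module.Basis.constr_basis, b.toWeightBasis_apply] at h1
    exact h1
  let t' : p := ⟨t, hHp t.2⟩
  let D₂ : LieDerivation K p p := D₁ - LieDerivation.ad K p t'
  have hD₂ : ∀ y, D₂ y = D₁ y - ⁅t', y⁆ := fun y ↦ by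
    rw [LieDerivation.sub_apply, LieDerivation.ad_apply_apply]
  have h0 := derivation_apply_eq_zero hp hS D₂ (fun y hy ↦ ?_) (fun α hα y hy ↦ ?_)
    (fun α hα y hy ↦ ?_)
  · refine ⟨t' - x, fun y ↦ ?_⟩
    have := h0 y
    rw [hD₂, hD₁, sub_eq_zero] at this
    rw [sub_lie, ← this, add_sub_cancel_right]
  · rw [hD₂, hD₁H y hy, zero_sub, neg_eq_zero]
    exact Subtype.ext (congrArg (fun u : H ↦ (u : L)) (trivial_lie_zero _ _ t (⟨y, hy⟩ : H)))
  · rw [hD₂]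
    refine sub_mem (hD₁root α hα y hy) ?_
    change ⁅(t : L), (y : L)⁆ ∈ _
    rw [show ⁅(t : L), (y : L)⁆ = α.1 t • (y : L) from lie_eq_smul_of_mem_rootSpace hy t]
    exact Submodule.smul_mem _ _ hy
  · have h1 : ⁅t', y⁆ = α.1 t • y := Subtype.ext (lie_eq_smul_of_mem_rootSpace hy t)
    rw [hD₂, h1, hc ⟨α, hα⟩ y hy, ht ⟨α, hα⟩, sub_self]

/-- For `t` in the Cartan subalgebra on which the roots of `D` vanish, the linear form
`κ(t, ·)` kills the derived algebra of the standard parabolic subalgebra, because a root space `L_α`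
and its opposite both lie in that subalgebra only if `α` is in the span of `D`. -/
theorem killingForm_lie_eq_zero {D : Finset H.root}
    (hp : p.toSubmodule = cartanAddRootSpaces H (parabolicRoots H b D)) {t : H}
    (ht : ∀ α ∈ D, α.1 t = 0) (x y : p) : killingForm K L t ⁅(x : L), (y : L)⁆ = 0 := by
  have hspan : ∀ f ∈ Submodule.span K ((rootSystem H).root '' D), f t = 0 := by
    intro f hf
    refine Submodule.span_induction ?_ rfl (fun f g _ _ hf hg ↦ ?_) (fun c f _ hf ↦ ?_) hf
    · rintro _ ⟨α, hα, rfl⟩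
      exact ht α hα
    · rw [LinearMap.add_apply, hf, hg, add_zero]
    · rw [LinearMap.smul_apply, hf, smul_zero]
  rw [killingForm, ← LieModule.traceForm_apply_lie_apply]
  let B : p →ₗ[K] L →ₗ[K] K :=
    killingForm K L ∘ₗ (LieAlgebra.ad K L (t : L) : L →ₗ[K] L) ∘ₗ p.toSubmodule.subtype
  have hB : ∀ (x : p) (y : L), B x y = killingForm K L ⁅(t : L), (x : L)⁆ y := fun _ _ ↦ rfl
  suffices h : ∀ y : p, B.flip.domRestrict p.toSubmodule y x = 0 from h y
  intro y
  refine linearMap_eq_zero_of_toSubmodule_eq hp _ (fun x hx ↦ ?_) (fun α hα x hx ↦ ?_) x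
  · change B x y = 0
    have : ⁅(t : L), (x : L)⁆ = 0 :=
      congrArg Subtype.val (trivial_lie_zero _ _ t (⟨x, hx⟩ : H))
    rw [hB, this, map_zero, LinearMap.zero_apply]
  · change B x y = 0
    have htx : ⁅(t : L), (x : L)⁆ = α.1 t • (x : L) := lie_eq_smul_of_mem_rootSpace hx t
    have hsub : ∀ y : p, ((B x).domRestrict p.toSubmodule) y = 0 := by
      refine linearMap_eq_zero_of_toSubmodule_eq hp _ (fun y hy ↦ ?_) (fun β hβ y hy ↦ ?_)
      · change B x y = 0
        rw [hB, htx, map_smul, LinearMap.smul_apply,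
          killingForm_apply_eq_zero_of_mem_rootSpace_of_add_ne_zero K L H (α := α.1) (β := 0) hx
            (by rw [rootSpace_zero_eq]; exact hy), smul_zero]
        rw [add_zero]
        exact fun h ↦ H.isNonZero_coe_root α h
      · change B x y = 0
        rw [hB, htx, map_smul, LinearMap.smul_apply]
        by_cases hαβ : (α.1 : H → K) + β.1 = 0
        · have hβα : β = negRoot α := root_ext (by
            rw [coe_negRoot]; exact eq_neg_of_add_eq_zero_right hαβ)
          have : α.1 t = 0 :=
            hspan _ (root_mem_span_of_mem_parabolicRoots hα (hβα ▸ hβ))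
          rw [this, zero_smul]
        · rw [killingForm_apply_eq_zero_of_mem_rootSpace_of_add_ne_zero K L H hx hy hαβ, smul_zero]
    exact hsub y

/-- The abelianization of the standard parabolic subalgebra attached to `D` has as its dual
the subspace of the Cartan subalgebra that is cut out by the roots in `D`. -/
theorem finrank_quotient_derivedSeries_one {D : Finset H.root} (hD : D ⊆ b.support)
    (hp : p.toSubmodule = cartanAddRootSpaces H (parabolicRoots H b D)) :
    Module.finrank K (p ⧸ (derivedSeries K p 1).toSubmodule) = b.support.card - D.card := by
  obtain ⟨hHp, hSp⟩ := le_of_toSubmodule_eq hp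
  let W : Submodule K H := (Submodule.span K ((rootSystem H).root '' D)).dualCoannihilator
  have hW : ∀ t ∈ W, ∀ α ∈ D, α.1 t = 0 := fun t ht α hα ↦
    (Submodule.mem_dualCoannihilator t).1 ht _ (Submodule.subset_span ⟨α, hα, rfl⟩)
  let C := (derivedSeries K p 1).toSubmodule
  let κ : W →ₗ[K] Module.Dual K p :=
    (Module.Dual.transpose (R := K) p.toSubmodule.subtype) ∘ₗ killingForm K L ∘ₗ
      H.toSubmodule.subtype ∘ₗ W.subtype
  have hκ : ∀ (t : W) (x : p), κ t x = killingForm K L (t : H) x := fun _ _ ↦ rfl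
  have hκC : ∀ t, κ t ∈ C.dualAnnihilator := by
    intro t
    rw [Submodule.mem_dualAnnihilator]
    intro x hx
    have : C ≤ LinearMap.ker (κ t) := derivedSeries_one_le fun x y ↦
      killingForm_lie_eq_zero hp (hW t t.2) x y
    exact this hx
  have hrestr : ∀ t u : H, killingForm K L (t : L) (u : L) = cartanEquivDual H t u := fun t u ↦ rfl
  let Θ : W →ₗ[K] C.dualAnnihilator := κ.codRestrict _ hκC
  have hΘ : Function.Bijective Θ := by
    constructor
    · rw [injective_iff_map_eq_zero]
      intro t ht
      have h1 : ∀ x : p, killingForm K L (t : H) x = 0 := fun x ↦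
        LinearMap.congr_fun (congrArg Subtype.val ht) x
      refine Subtype.ext ((cartanEquivDual H).map_eq_zero_iff.1 (LinearMap.ext fun u ↦ ?_))
      rw [← hrestr]
      exact h1 ⟨u, hHp u.2⟩
    · rintro ⟨f, hf⟩
      rw [Submodule.mem_dualAnnihilator] at hf
      have hf' : ∀ x y : p, f ⁅x, y⁆ = 0 := fun x y ↦ hf _ (lie_mem_derivedSeries_one x y)
      let fH : Module.Dual K H :=
        f ∘ₗ Submodule.inclusion (show H.toSubmodule ≤ p.toSubmodule from hHp)
      let t : H := (cartanEquivDual H).symm fH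
      have ht : ∀ u : H, killingForm K L (t : L) u = f ⟨u, hHp u.2⟩ := fun u ↦ by
        rw [hrestr, LinearEquiv.apply_symm_apply]; rfl
      have htW : t ∈ W := by
        have hle : Submodule.span K ((rootSystem H).root '' D) ≤
            LinearMap.ker (Module.Dual.eval K H t) := by
          rw [Submodule.span_le]
          rintro _ ⟨α, hα, rfl⟩
          obtain ⟨e, he, e', he', hee, -⟩ := exists_lie_eq_cartanEquivDual_symm α
          rw [← coe_negRoot] at he'
          have hαS : α ∈ parabolicRoots H b D :=
            Or.inl (mem_positiveRoots_of_mem_support (hD hα))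
          have hαS' : negRoot α ∈ parabolicRoots H b D := by
            refine Or.inr ?_
            change _ ∈ Submodule.span K _
            rw [rootSystem_root_negRoot]
            exact neg_mem (Submodule.subset_span ⟨α, hα, rfl⟩)
          have h1 := hf' ⟨e, hSp _ hαS e he⟩ ⟨e', hSp _ hαS' e' he'⟩
          have h2 := ht ((cartanEquivDual H).symm α.1)
          have h3 : f ⟨((cartanEquivDual H).symm α.1 : H), hHp (Subtype.property _)⟩ = 0 := by
            rw [← h1]; congr 1; exact Subtype.ext hee.symm
          rw [h3, LieModule.traceForm_comm, ← killingForm, hrestr,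
            LinearEquiv.apply_symm_apply] at h2
          exact h2
        exact (Submodule.mem_dualCoannihilator t).2 fun φ hφ ↦ hle hφ
      refine ⟨⟨t, htW⟩, Subtype.ext (sub_eq_zero.1 (LinearMap.ext fun x ↦ ?_))⟩
      obtain ⟨h, hreg⟩ := exists_regular H
      refine linearMap_eq_zero_of_toSubmodule_eq hp _ (fun x hx ↦ ?_) (fun α hα x hx ↦ ?_) x
      · exact sub_eq_zero.2 (ht ⟨x, hx⟩)
      -- A root vector is a bracket, so that both linear forms vanish on it.
      · have h1 : ⁅(⟨h, hHp h.2⟩ : p), (α.1 h)⁻¹ • x⁆ = x := by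
          refine Subtype.ext ?_
          change ⁅(h : L), (α.1 h)⁻¹ • (x : L)⁆ = x
          rw [lie_smul, show ⁅(h : L), (x : L)⁆ = α.1 h • (x : L) from
            lie_eq_smul_of_mem_rootSpace hx h, smul_smul, inv_mul_cancel₀ (hreg α), one_smul]
        have h2 : x ∈ C := h1 ▸ lie_mem_derivedSeries_one _ _
        exact sub_eq_zero.2 (((Submodule.mem_dualAnnihilator _).1 (hκC ⟨t, htW⟩) x h2).trans
          (hf x h2).symm)
  have h1 := (LinearEquiv.ofBijective Θ hΘ).finrank_eq
  have h2 := Subspace.finrank_add_finrank_dualAnnihilator_eq C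
  have h3 := Submodule.finrank_quotient_add_finrank C
  have h4 := Subspace.finrank_add_finrank_dualCoannihilator_eq
    (Submodule.span K ((rootSystem H).root '' (D : Set H.root)))
  have h5 : Module.finrank K (Submodule.span K ((rootSystem H).root '' (D : Set H.root))) =
      D.card := by
    have hli : LinearIndepOn K (rootSystem H).root (D : Set H.root) :=
      b.linearIndepOn_root.mono (by exact_mod_cast hD)
    have := finrank_span_eq_card hli
    rw [Set.image_eq_range]
    simpa using this
  have h6 : Module.finrank K H = b.support.card := by
    rw [← Subspace.dual_finrank_eq, Module.finrank_eq_card_basis b.toWeightBasis,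
      Fintype.card_coe]
  change Module.finrank K (p ⧸ C) = _
  change _ + Module.finrank K W = _ at h4
  omega

end StandardParabolic

end ParabolicDer

/-! ### The derivation algebra of a parabolic subalgebra -/

theorem proposition3p2 {K : Type*} [Field K] [CharZero K] [IsAlgClosed K]
    {g : Type*} [LieRing g] [LieAlgebra K g] [FiniteDimensional K g]
    [LieAlgebra.HasCentralRadical K g]
    (gS : LieIdeal K g) [LieAlgebra.IsSemisimple K gS]
    (hgS : ∀ I : LieIdeal K g, LieAlgebra.IsSemisimple K I → gS ≤ I → I = gS)
    (n : ℕ) (hn : Module.finrank K (LieAlgebra.center K g) = n)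
    (q : LieSubalgebra K g) (hq : ParabolicDer.IsReductiveParabolic gS q) :
    (∃ (H : LieSubalgebra K gS) (_ : H.IsCartanSubalgebra)
      (b : (LieAlgebra.IsKilling.rootSystem H).Base) (D : Finset H.root),
      ParabolicDer.IsStandardParabolic H b D (ParabolicDer.semisimplePart gS q)) ∧
    ∀ (H : LieSubalgebra K gS) [H.IsCartanSubalgebra]
      (b : (LieAlgebra.IsKilling.rootSystem H).Base) (D : Finset H.root),
      ParabolicDer.IsStandardParabolic H b D (ParabolicDer.semisimplePart gS q) →
      Module.finrank K (LieDerivation K q q) =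
        (n + b.support.card - D.card) * n +
          Module.finrank K (ParabolicDer.semisimplePart gS q) := by
  refine ⟨hq.2.exists_isStandardParabolic, ?_⟩
  rintro H _ b D ⟨hD, hp⟩
  have hS : ParabolicDer.positiveRoots H b ⊆ ParabolicDer.parabolicRoots H b D :=
    Set.subset_union_left
  have hgS' := ParabolicDer.eq_derivedSeries_one_of_maximal gS hgS
  let p := ParabolicDer.semisimplePart gS q
  have hpq : ∀ x : gS, x ∈ p ↔ (x : g) ∈ q := fun x ↦ Iff.rfl
  let ι : p →ₗ⁅K⁆ q :=
    { toFun := fun x ↦ ⟨(x : gS), (hpq x).1 x.2⟩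
      map_add' := fun _ _ ↦ rfl
      map_smul' := fun _ _ ↦ rfl
      map_lie' := rfl }
  have hιcoe : ∀ x : p, (ι x : g) = ((x : gS) : g) := fun _ ↦ rfl
  have hι : Function.Injective ι := fun x y hxy ↦
    Subtype.ext (Subtype.ext (congrArg (fun u : q ↦ (u : g)) hxy))
  have hpcenter := ParabolicDer.eq_zero_of_forall_lie_eq_zero hp hS
  have hZ : ∀ z ∈ LieAlgebra.center K g, ∀ y : g, ⁅y, z⁆ = 0 := fun z hz ↦
    (LieModule.mem_maxTrivSubmodule (R := K) (L := g) (M := g) z).1 hz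
  -- Every element of `q` splits as a central element of `g` and an element of `q ∩ gS`.
  have hdecomp : ∀ x : q, ∃ z : q, (z : g) ∈ LieAlgebra.center K g ∧ ∃ w : p, z + ι w = x := by
    intro x
    obtain ⟨z, hz, y, hy, hzy⟩ :=
      ParabolicDer.exists_center_add_derivedSeries_one (K := K) (x : g)
    rw [← hgS'] at hy
    have hzq : z ∈ q := hq.1 hz
    have hyq : y ∈ q := by
      have : y = (x : g) - z := by rw [← hzy, add_sub_cancel_left]
      rw [this]
      exact sub_mem x.2 hzq
    exact ⟨⟨z, hzq⟩, hz, ⟨⟨y, hy⟩, hyq⟩, Subtype.ext hzy⟩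
  have hcenter : ∀ x : q, x ∈ LieAlgebra.center K q ↔ (x : g) ∈ LieAlgebra.center K g := by
    intro x
    constructor
    · intro hx
      obtain ⟨z, hz, w, rfl⟩ := hdecomp x
      have hx' := (LieModule.mem_maxTrivSubmodule (R := K) (L := q) (M := q) _).1 hx
      have hw : w = 0 := by
        refine hpcenter w fun y ↦ hι ?_
        have h1 := hx' (ι y)
        have h2 : ⁅ι y, z⁆ = 0 := Subtype.ext (hZ z hz _)
        rw [lie_add, h2, zero_add] at h1
        rw [LieHom.map_lie, ← lie_skew, h1, neg_zero, map_zero]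
      rw [hw, map_zero, add_zero]
      exact hz
    · intro hx
      exact (LieModule.mem_maxTrivSubmodule (R := K) (L := q) (M := q) _).2 fun y ↦
        Subtype.ext (hZ x hx y)
  have hcompl : IsCompl (LieAlgebra.center K q).toSubmodule
      (LinearMap.range (ι : p →ₗ[K] q)) := by
    constructor
    · rw [Submodule.disjoint_def]
      rintro _ hx ⟨w, rfl⟩
      have h1 : ((w : gS) : g) ∈ LieAlgebra.derivedSeries K g 1 := hgS' ▸ (w : gS).2
      exact Subtype.ext (ParabolicDer.eq_zero_of_mem_center_of_mem_derivedSeries_one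
        ((hcenter _).1 hx) h1)
    · rw [codisjoint_iff, eq_top_iff]
      rintro x -
      obtain ⟨z, hz, w, rfl⟩ := hdecomp x
      exact Submodule.add_mem_sup ((hcenter z).2 hz) ⟨w, rfl⟩
  have hfin : Module.finrank K (LieAlgebra.center K q) = n := by
    rw [← hn]
    let e : LieAlgebra.center K q ≃ₗ[K] LieAlgebra.center K g :=
      { toFun := fun x ↦ ⟨(x : q), (hcenter x).1 x.2⟩
        map_add' := fun _ _ ↦ rfl
        map_smul' := fun _ _ ↦ rfl
        invFun := fun z ↦ ⟨⟨z, hq.1 z.2⟩, (hcenter ⟨z, hq.1 z.2⟩).2 z.2⟩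
        left_inv := fun _ ↦ rfl
        right_inv := fun _ ↦ rfl }
    exact e.finrank_eq
  rw [ParabolicDer.finrank_lieDerivation_of_isCompl_center ι hι hcompl hpcenter
    (ParabolicDer.exists_derivation_eq_lie hp hS), hfin,
    ParabolicDer.finrank_quotient_derivedSeries_one hD hp,
    Nat.add_sub_assoc (Finset.card_le_card hD)]
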